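/- For $x\in\mathbb R^2$ let $\omega(x)=e^{-1/|x|}/|x|^2$ if $x\ne 0$ and $\omega(0)=0$, and let $$d(x,y)=\inf_\gamma\int_\gamma\omega\,ds=\inf_\gamma\int_0^1\omega(\gamma(t))\,|\gamma'(t)|\,dt ,$$ the infimum being over all absolutely continuous paths $\gamma\colon[0,1]\to\mathbb R^2$ with $\gamma(0)=x$, $\gamma(1)=y$; $d$ is a metric on $\mathbb R^2$. Let $\iota\colon(\mathbb R^2,|\cdot|)\to(\mathbb R^2,d)$ be the identity map and $h\colon\mathbb R^2\to\mathbb R^2$, $h(x_1,x_2)=(x_1/2,x_2)$. A homeomorphism $f\colon(X,d_X)\to(Y,d_Y)$ of metric spaces is * *metrically quasiconformal (MQC) with constant $H\ge 1$* if for every $x\in X$ $$\limsup_{r\to0^+}\frac{\sup\{d_Y(f(x),f(y)): d_X(x,y)\le r\}}{\inf\{d_Y(f(x),f(y)): d_X(x,y)\ge r\}}\le H,$$ and *MQC* if this holds for some $H\ge1$; * *infinitesimally quasisymmetric (I-QS)* if there is a homeomorphism $\eta\colon[0,\infty)\to[0,\infty)$ such that every $x\in X$ has a radius $r_x>0$ for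 which, for all $y,z\in B(x,r_x)$ with $x,y,z$ distinct and all $t\ge0$, $d_X(x,y)/d_X(x,z)\le t$ implies $d_Y(f(x),f(y))/d_Y(f(x),f(z))\le\eta(t)$; * *geometrically $K$-quasiconformal ($K$-QC)*, $K\ge1$, if $K^{-1}\operatorname{Mod}\Gamma\le\operatorname{Mod}f\Gamma\le K\operatorname{Mod}\Gamma$ for every family $\Gamma$ of curves in $X$, where $f\Gamma=\{f(C):C\in\Gamma\}$. Here a curve is the image of a continuous map from a nonempty interval, and $\operatorname{Mod}\Gamma=\inf_\rho\int\rho^2\,d\mathcal H^2$ over all Borel $\rho\colon X\to[0,\infty]$ with $\int_C\rho\,d\mathcal H^1\ge1$ for every $C\in\Gamma$ of locally finite $\mathcal H^1$-measure (that is, each point of $C$ has a neighbourhood $U$ with $\mathcal H^1(C\cap U)<\infty$); $\mathcal H^m$ is the $m$-dimensional Hausdorff measure of the space in question, normalized by $\alpha(m)2^{-m}\operatorname{diam}^m$ with $\alpha(1)=2$, $\alpha(2)=\pi$. Then: (a) $\iota$ is MQC with $H=1$, and so is $\iota^{-1}$; (b) $\iota$ is $1$-QC; (c) $\iota$ is not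 I-QS; (d) $(\iota\circ h)^{-1}$ is MQC; (e) $\iota\circ h$ is not MQC. -/

import Mathlib

open MeasureTheory Filter Set
open scoped NNReal ENNReal Topology

noncomputable section

/-! ### Absolutely continuous paths: composition lemmas -/

theorem acOn_comp_lipschitz {X Y : Type*} [PseudoMetricSpace X] [PseudoMetricSpace Y]
    {γ : ℝ → X} {a b : ℝ} (hγ : AbsolutelyContinuousOnInterval γ a b) {g : X → Y} {K : ℝ≥0}
    (hg : LipschitzWith K g) : AbsolutelyContinuousOnInterval (fun t => g (γ t)) a b := by
  unfold AbsolutelyContinuousOnInterval at hγ ⊢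
  refine squeeze_zero (fun _ => Finset.sum_nonneg fun _ _ => dist_nonneg) (fun E => ?_)
    (by simpa using hγ.const_mul (K : ℝ))
  rw [Finset.mul_sum]
  exact Finset.sum_le_sum fun i _ => hg.dist_le_mul _ _

theorem acOn_reparam {X : Type*} [PseudoMetricSpace X] {γ : ℝ → X} {a b c d : ℝ}
    (hγ : AbsolutelyContinuousOnInterval γ c d) {φ : ℝ → ℝ} {K : ℝ≥0}
    (hφ : LipschitzWith K φ) (hm : Monotone φ ∨ Antitone φ)
    (hmaps : MapsTo φ (uIcc a b) (uIcc c d)) :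
    AbsolutelyContinuousOnInterval (fun t => γ (φ t)) a b := by
  rw [absolutelyContinuousOnInterval_iff] at hγ ⊢
  intro ε hε
  obtain ⟨δ, hδ, H⟩ := hγ ε hε
  refine ⟨δ / (K + 1), by positivity, fun E hE hlen => ?_⟩
  refine H (E.1, fun i => (φ (E.2 i).1, φ (E.2 i).2)) ⟨fun i hi => ?_, ?_⟩ ?_
  · exact ⟨hmaps (hE.1 i hi).1, hmaps (hE.1 i hi).2⟩
  · intro i hi j hj hij
    have h := hE.2 hi hj hij
    simp only [Function.onFun, uIoc, Set.Ioc_disjoint_Ioc] at h ⊢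
    rcases hm with hm | hm
    · simpa only [hm.map_min, hm.map_max] using hm h
    · simpa only [hm.map_min, hm.map_max] using hm h
  · calc ∑ i ∈ Finset.range E.1, dist (φ (E.2 i).1) (φ (E.2 i).2)
        ≤ ∑ i ∈ Finset.range E.1, (K : ℝ) * dist (E.2 i).1 (E.2 i).2 :=
          Finset.sum_le_sum fun i _ => hφ.dist_le_mul _ _
      _ = (K : ℝ) * ∑ i ∈ Finset.range E.1, dist (E.2 i).1 (E.2 i).2 := by
          rw [Finset.mul_sum]
      _ ≤ (K : ℝ) * (δ / (K + 1)) := by gcongr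
      _ < (K + 1) * (δ / (K + 1)) := by gcongr; linarith
      _ = δ := by field_simp

/-! ### The weight and the associated distance -/

/-- The Euclidean plane. -/
abbrev Plane : Type := EuclideanSpace ℝ (Fin 2)

/-- The conformal weight `ω(x) = e^{-1/|x|} / |x|²` for `x ≠ 0`, `ω(0) = 0`. -/
def weight (x : Plane) : ℝ := if x = 0 then 0 else Real.exp (-(1 / ‖x‖)) / ‖x‖ ^ 2

/-- The weighted length `∫_γ ω ds = ∫₀¹ ω(γ(t)) |γ'(t)| dt` of an absolutely continuous path
`γ : [0,1] → ℝ²` (values of `γ` outside `[0,1]` are irrelevant). -/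
def weightedLength (γ : ℝ → Plane) : ℝ≥0∞ :=
  ∫⁻ t in Icc (0 : ℝ) 1, ENNReal.ofReal (weight (γ t) * ‖deriv γ t‖)

/-- `γ` restricted to `[0,1]` is an absolutely continuous path from `x` to `y`. -/
structure IsACPath (γ : ℝ → Plane) (x y : Plane) : Prop where
  ac : AbsolutelyContinuousOnInterval γ 0 1
  source : γ 0 = x
  target : γ 1 = y

/-- The infimum of the weighted lengths of the absolutely continuous paths from `x` to `y`. -/
def weightedEDist (x y : Plane) : ℝ≥0∞ :=
  ⨅ (γ : ℝ → Plane) (_ : IsACPath γ x y), weightedLength γ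

theorem weight_nonneg (x : Plane) : 0 ≤ weight x := by
  unfold weight; split_ifs <;> positivity

theorem weight_le_two (x : Plane) : weight x ≤ 2 := by
  unfold weight
  split_ifs with h
  · norm_num
  · have hx : 0 < ‖x‖ := norm_pos_iff.2 h
    rw [div_le_iff₀ (by positivity), Real.exp_neg]
    have h1 := Real.quadratic_le_exp_of_nonneg (x := 1 / ‖x‖) (by positivity)
    rw [inv_le_comm₀ (Real.exp_pos _) (by positivity)]
    refine le_trans ?_ h1
    have : (2 * ‖x‖ ^ 2)⁻¹ = (1 / ‖x‖) ^ 2 / 2 := by field_simp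
    rw [this]
    have : 0 < 1 / ‖x‖ := by positivity
    linarith

theorem weightedEDist_le {γ : ℝ → Plane} {x y : Plane} (h : IsACPath γ x y) :
    weightedEDist x y ≤ weightedLength γ := iInf₂_le γ h

theorem weightedEDist_self (x : Plane) : weightedEDist x x = 0 := by
  refine le_antisymm ((weightedEDist_le (γ := fun _ => x) ⟨?_, rfl, rfl⟩).trans ?_) bot_le
  · exact ((LipschitzWith.const x).lipschitzOnWith).absolutelyContinuousOnInterval
  · simp [weightedLength]

theorem weightedEDist_ne_top (x y : Plane) : weightedEDist x y ≠ ⊤ := by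
  have hd : ∀ t : ℝ, HasDerivAt (fun t : ℝ => x + t • (y - x)) (y - x) t := fun t => by
    simpa using ((hasDerivAt_id t).smul_const (y - x)).const_add x
  refine ne_top_of_le_ne_top ?_ (weightedEDist_le (γ := fun t : ℝ => x + t • (y - x))
    ⟨?_, by simp, by simp⟩)
  · refine ne_top_of_le_ne_top (b := ∫⁻ _ in Icc (0 : ℝ) 1, ENNReal.ofReal (2 * ‖y - x‖))
      (by simp [ENNReal.mul_eq_top]) ?_
    refine lintegral_mono fun t => ENNReal.ofReal_le_ofReal ?_
    rw [(hd t).deriv]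
    exact mul_le_mul_of_nonneg_right (weight_le_two _) (norm_nonneg _)
  · refine ContDiffOn.absolutelyContinuousOnInterval (ContDiff.contDiffOn ?_)
    fun_prop

theorem weightedLength_eq_Ioo (γ : ℝ → Plane) :
    weightedLength γ = ∫⁻ t in Ioo (0 : ℝ) 1, ENNReal.ofReal (weight (γ t) * ‖deriv γ t‖) := by
  unfold weightedLength
  rw [restrict_Ioo_eq_restrict_Icc]

/-- The weighted length of the part of a path that is an affine reparametrization of `γ`. -/
theorem lintegral_affine_reparam {γ σ : ℝ → Plane} {m q : ℝ} (hm : m ≠ 0) {s : Set ℝ}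
    (hs : IsOpen s) (hσ : ∀ t ∈ s, σ t = γ (m * t + q))
    (hmaps : MapsTo (fun t => m * t + q) s (Ioo 0 1)) :
    ∫⁻ t in s, ENNReal.ofReal (weight (σ t) * ‖deriv σ t‖) ≤ weightedLength γ := by
  have hinj : InjOn (fun t => m * t + q) s := fun a _ b _ h => by
    have : m * a + q = m * b + q := h
    exact mul_left_cancel₀ hm (by linarith)
  have hder : ∀ t ∈ s, HasDerivWithinAt (fun t => m * t + q) m s t := fun t _ => by
    simpa using (((hasDerivAt_id t).const_mul m).add_const q).hasDerivWithinAt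
  have h := lintegral_image_eq_lintegral_abs_deriv_mul hs.measurableSet hder hinj
    (fun u => ENNReal.ofReal (weight (γ u) * ‖deriv γ u‖))
  rw [weightedLength_eq_Ioo]
  refine le_trans (le_of_eq ?_) (lintegral_mono_set hmaps.image_subset)
  rw [h]
  refine setLIntegral_congr_fun hs.measurableSet fun t ht => ?_
  have hev : σ =ᶠ[𝓝 t] fun t => γ (m * t + q) :=
    Filter.eventually_of_mem (hs.mem_nhds ht) hσ
  have hd : deriv σ t = m • deriv γ (m * t + q) := by
    rw [hev.deriv_eq, deriv_comp_mul_left m (fun u => γ (u + q)) t, deriv_comp_add_const]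
  simp only [hd, hσ t ht, norm_smul, Real.norm_eq_abs]
  rw [← ENNReal.ofReal_mul (abs_nonneg m)]
  congr 1
  ring

theorem weightedEDist_comm_le (x y : Plane) : weightedEDist x y ≤ weightedEDist y x := by
  refine le_iInf₂ fun γ hγ => ?_
  refine (weightedEDist_le (γ := fun t => γ (-1 * t + 1)) ⟨?_, ?_, ?_⟩).trans ?_
  · refine acOn_reparam hγ.ac (φ := fun t => -1 * t + 1) (K := 1) ?_ (Or.inr ?_) ?_
    · refine LipschitzWith.of_dist_le_mul fun s t => ?_
      rw [Real.dist_eq, Real.dist_eq, abs_sub_comm s t]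
      apply le_of_eq
      simp only [NNReal.coe_one, one_mul]
      congr 1
      ring
    · intro s t h
      simp only
      linarith
    · intro t ht
      rw [uIcc_of_le zero_le_one, mem_Icc] at ht ⊢
      constructor <;> linarith [ht.1, ht.2]
  · simpa using hγ.target
  · simpa using hγ.source
  · rw [weightedLength_eq_Ioo]
    refine lintegral_affine_reparam (m := -1) (q := 1) (by norm_num) isOpen_Ioo
      (fun _ _ => rfl) fun t ht => ?_
    constructor <;> linarith [ht.1, ht.2]

theorem weightedEDist_triangle (x y z : Plane) :
    weightedEDist x z ≤ weightedEDist x y + weightedEDist y z := by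
  conv_rhs => rw [weightedEDist, weightedEDist]
  simp only [ENNReal.iInf_add, ENNReal.add_iInf]
  refine le_iInf₂ fun η hη => le_iInf₂ fun γ hγ => ?_
  have hL : LipschitzWith 2 (fun t : ℝ => 2 * t) := LipschitzWith.of_dist_le_mul fun s t => by
    rw [Real.dist_eq, Real.dist_eq, ← mul_sub, abs_mul]
    simp
  have hL' : LipschitzWith 2 (fun t : ℝ => 2 * t - 1) := LipschitzWith.of_dist_le_mul fun s t => by
    rw [Real.dist_eq, Real.dist_eq, show 2 * s - 1 - (2 * t - 1) = 2 * (s - t) by ring, abs_mul]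
    simp
  have h1 : AbsolutelyContinuousOnInterval (fun t => γ (min (2 * t) 1)) 0 1 := by
    refine acOn_reparam hγ.ac (φ := fun t => min (2 * t) 1) (hL.min_const 1) (Or.inl ?_) ?_
    · intro s t h
      exact min_le_min_right _ (by linarith)
    · intro t ht
      rw [uIcc_of_le zero_le_one, mem_Icc] at ht ⊢
      exact ⟨le_min (by linarith [ht.1]) zero_le_one, min_le_right _ _⟩
  have h2 : AbsolutelyContinuousOnInterval (fun t => η (max (2 * t - 1) 0)) 0 1 := by
    refine acOn_reparam hη.ac (φ := fun t => max (2 * t - 1) 0) (hL'.max_const 0) (Or.inl ?_) ?_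
    · intro s t h
      exact max_le_max_right _ (by linarith)
    · intro t ht
      rw [uIcc_of_le zero_le_one, mem_Icc] at ht ⊢
      exact ⟨le_max_right _ _, max_le (by linarith [ht.2]) zero_le_one⟩
  have h3 : AbsolutelyContinuousOnInterval (fun _ : ℝ => y) 0 1 :=
    ((LipschitzWith.const y).lipschitzOnWith).absolutelyContinuousOnInterval
  set σ : ℝ → Plane := fun t => γ (min (2 * t) 1) + η (max (2 * t - 1) 0) - y with hσ
  have hpath : IsACPath σ x z := by
    refine ⟨(h1.fun_add h2).fun_sub h3, ?_, ?_⟩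
    · simp [hσ, hγ.source, hη.source]
    · norm_num [hσ, hγ.target, hη.target]
  refine (weightedEDist_le hpath).trans ?_
  have hsub : Icc (0 : ℝ) 1 ⊆ Icc 0 (1 / 2) ∪ Icc (1 / 2) 1 := by
    intro t ht
    rcases le_total t (1 / 2) with h | h
    · exact Or.inl ⟨ht.1, h⟩
    · exact Or.inr ⟨h, ht.2⟩
  unfold weightedLength
  refine (lintegral_mono_set hsub).trans ((lintegral_union_le _ _ _).trans ?_)
  rw [← restrict_Ioo_eq_restrict_Icc (a := (0 : ℝ)) (b := 1 / 2),
    ← restrict_Ioo_eq_restrict_Icc (a := (1 / 2 : ℝ)) (b := 1)]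
  refine add_le_add ?_ ?_
  · refine lintegral_affine_reparam (m := 2) (q := 0) (by norm_num) isOpen_Ioo
      (fun t ht => ?_) fun t ht => ?_
    · have e1 : min (2 * t) 1 = 2 * t + 0 := by
        rw [add_zero]; exact min_eq_left (by linarith [ht.2])
      have e2 : max (2 * t - 1) 0 = 0 := max_eq_right (by linarith [ht.2])
      simp only [hσ, e1, e2, hη.source, add_sub_cancel_right]
    · constructor <;> linarith [ht.1, ht.2]
  · refine lintegral_affine_reparam (m := 2) (q := -1) (by norm_num) isOpen_Ioo
      (fun t ht => ?_) fun t ht => ?_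
    · have e1 : min (2 * t) 1 = 1 := min_eq_right (by linarith [ht.1])
      have e2 : max (2 * t - 1) 0 = 2 * t + -1 := by
        rw [← sub_eq_add_neg]; exact max_eq_left (by linarith [ht.1])
      simp only [hσ, e1, e2, hγ.target, add_sub_cancel_left]
    · constructor <;> linarith [ht.1, ht.2]

/-- A `c`-Lipschitz function that is locally constant wherever `ω < c` is `1`-Lipschitz for the
weighted distance. -/
theorem ofReal_sub_le_weightedEDist {φ : Plane → ℝ} {c : ℝ≥0} (hφ : LipschitzWith c φ)
    (hloc : ∀ z, (c : ℝ) ≤ weight z ∨ ∃ k, ∀ᶠ w in 𝓝 z, φ w = k) (x y : Plane) :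
    ENNReal.ofReal (φ y - φ x) ≤ weightedEDist x y := by
  refine le_iInf₂ fun γ hγ => ?_
  have hac := acOn_comp_lipschitz hγ.ac hφ
  have hint := hac.integral_deriv_eq_sub
  rw [hγ.source, hγ.target] at hint
  rw [← hint, intervalIntegral.integral_of_le zero_le_one]
  refine (ENNReal.ofReal_le_ofReal (le_abs_self _)).trans ?_
  rw [← Real.norm_eq_abs, ofReal_norm]
  refine (enorm_integral_le_lintegral_enorm _).trans ?_
  rw [restrict_Ioc_eq_restrict_Icc]
  unfold weightedLength
  refine lintegral_mono_ae ?_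
  rw [ae_restrict_iff' measurableSet_Icc]
  have hdiff : ∀ᵐ t, t ∈ uIcc (0 : ℝ) 1 → DifferentiableAt ℝ γ t :=
    hγ.ac.boundedVariationOn.ae_differentiableAt_of_mem_uIcc
  filter_upwards [hdiff, hac.ae_differentiableAt] with t ht1 ht2 ht
  rw [← uIcc_of_le zero_le_one] at ht
  have d1 := (ht1 ht).hasDerivAt
  have d2 := (ht2 ht).hasDerivAt
  rw [← ofReal_norm]
  refine ENNReal.ofReal_le_ofReal ?_
  rcases hloc (γ t) with h | ⟨k, hk⟩
  · refine le_trans ?_ (mul_le_mul_of_nonneg_right h (norm_nonneg _))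
    have l1 := (hasDerivAt_iff_tendsto_slope.1 d1).norm
    have l2 := (hasDerivAt_iff_tendsto_slope.1 d2).norm
    refine le_of_tendsto_of_tendsto l2 (l1.const_mul (c : ℝ)) (Eventually.of_forall fun s => ?_)
    simp only [slope_def_module, norm_smul]
    have := hφ.dist_le_mul (γ s) (γ t)
    rw [dist_eq_norm, dist_eq_norm] at this
    calc ‖(s - t)⁻¹‖ * ‖φ (γ s) - φ (γ t)‖ ≤ ‖(s - t)⁻¹‖ * (c * ‖γ s - γ t‖) := by gcongr
      _ = c * (‖(s - t)⁻¹‖ * ‖γ s - γ t‖) := by ring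
  · have hev : (fun t => φ (γ t)) =ᶠ[𝓝 t] fun _ => k := d1.continuousAt.eventually hk
    rw [hev.deriv_eq]
    simp only [deriv_const, norm_zero]
    exact mul_nonneg (weight_nonneg _) (norm_nonneg _)

theorem weightedEDist_pos_aux {x y : Plane} (hx : x ≠ 0) (hxy : x ≠ y) :
    weightedEDist y x ≠ 0 := by
  have hx' : 0 < ‖x‖ := norm_pos_iff.2 hx
  set δ : ℝ := ‖x‖ / 2 with hδ
  have hδ0 : 0 < δ := by positivity
  have hne : ∀ z ∈ Metric.closedBall x δ, z ≠ 0 := by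
    rintro z hz rfl
    rw [Metric.mem_closedBall, dist_zero_left] at hz
    linarith
  obtain ⟨z₀, hz₀, hmin⟩ := (isCompact_closedBall x δ).exists_isMinOn
    ⟨x, Metric.mem_closedBall_self hδ0.le⟩
    (f := fun z : Plane => Real.exp (-(1 / ‖z‖)) / ‖z‖ ^ 2) (by
      refine ContinuousOn.div ?_ ?_ ?_
      · refine Real.continuous_exp.comp_continuousOn
          ((continuousOn_const.div continuous_norm.continuousOn fun z hz => ?_).neg)
        exact norm_ne_zero_iff.2 (hne z hz)
      · fun_prop
      · exact fun z hz => pow_ne_zero _ (norm_ne_zero_iff.2 (hne z hz)))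
  have hc0 : 0 < Real.exp (-(1 / ‖z₀‖)) / ‖z₀‖ ^ 2 := by
    have := norm_pos_iff.2 (hne z₀ hz₀)
    positivity
  obtain ⟨c, hc⟩ : ∃ c : ℝ≥0, (c : ℝ) = Real.exp (-(1 / ‖z₀‖)) / ‖z₀‖ ^ 2 :=
    ⟨⟨_, hc0.le⟩, rfl⟩
  have hcpos : (0 : ℝ) < c := by rw [hc]; exact hc0
  have hw : ∀ z ∈ Metric.closedBall x δ, (c : ℝ) ≤ weight z := fun z hz => by
    rw [weight, if_neg (hne z hz), hc]
    exact hmin hz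
  have hlip : LipschitzWith c (fun z => max ((c : ℝ) * (δ - dist z x)) 0) := by
    refine LipschitzWith.max_const (LipschitzWith.of_dist_le_mul fun z w => ?_) 0
    rw [Real.dist_eq, ← mul_sub, abs_mul, abs_of_pos hcpos]
    gcongr
    rw [show δ - dist z x - (δ - dist w x) = dist w x - dist z x by ring, abs_sub_comm]
    exact abs_dist_sub_le _ _ _
  have h := ofReal_sub_le_weightedEDist hlip (fun z => ?_) y x
  · refine (lt_of_lt_of_le (ENNReal.ofReal_pos.2 ?_) h).ne'
    have : 0 < dist y x := dist_pos.2 hxy.symm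
    rw [dist_self, sub_zero, sub_pos]
    refine lt_max_of_lt_left (max_lt ?_ (by positivity))
    gcongr
    linarith
  · by_cases hz : z ∈ Metric.closedBall x δ
    · exact Or.inl (hw z hz)
    · refine Or.inr ⟨0, ?_⟩
      filter_upwards [Metric.isClosed_closedBall.isOpen_compl.mem_nhds hz] with w hw
      rw [mem_compl_iff, Metric.mem_closedBall, not_le] at hw
      refine max_eq_right ?_
      exact mul_nonpos_of_nonneg_of_nonpos c.2 (by linarith)

theorem weightedEDist_comm (x y : Plane) : weightedEDist x y = weightedEDist y x :=
  le_antisymm (weightedEDist_comm_le x y) (weightedEDist_comm_le y x)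

theorem eq_of_weightedEDist_eq_zero {x y : Plane} (h : weightedEDist x y = 0) : x = y := by
  by_contra hxy
  by_cases hx : x = 0
  · exact weightedEDist_pos_aux (x := y) (y := x) (fun hy => hxy (hx.trans hy.symm))
      (Ne.symm hxy) h
  · exact weightedEDist_pos_aux hx hxy (weightedEDist_comm x y ▸ h)

/-! ### The metric space `(ℝ², d)` -/

/-- The plane `(ℝ², d)`, where `d(x, y)` is the infimum of `∫_γ ω ds` over the absolutely
continuous paths from `x` to `y`. -/
structure WeightedPlane : Type where
  /-- The underlying point of `ℝ²`. -/
  pt : Plane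

instance : MetricSpace WeightedPlane where
  dist p q := (weightedEDist p.pt q.pt).toReal
  dist_self p := by simp [weightedEDist_self]
  dist_comm p q := by simp only [weightedEDist_comm p.pt q.pt]
  dist_triangle p q r := by
    rw [← ENNReal.toReal_add (weightedEDist_ne_top _ _) (weightedEDist_ne_top _ _)]
    exact ENNReal.toReal_mono
      (ENNReal.add_ne_top.2 ⟨weightedEDist_ne_top _ _, weightedEDist_ne_top _ _⟩)
      (weightedEDist_triangle _ _ _)
  eq_of_dist_eq_zero {p q} h := by
    have h0 : weightedEDist p.pt q.pt = 0 :=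
      ((ENNReal.toReal_eq_zero_iff _).1 h).resolve_right (weightedEDist_ne_top _ _)
    cases p
    cases q
    exact congrArg _ (eq_of_weightedEDist_eq_zero h0)

instance : MeasurableSpace WeightedPlane := borel WeightedPlane

instance : BorelSpace WeightedPlane := ⟨rfl⟩

/-- The identity map `ι : (ℝ², |·|) → (ℝ², d)`. -/
def iotaMap : Plane ≃ WeightedPlane where
  toFun x := ⟨x⟩
  invFun p := p.pt
  left_inv _ := rfl
  right_inv _ := rfl

/-- The linear map `h(x₁, x₂) = (x₁ / 2, x₂)` of the plane. -/
def halfMap : Plane ≃ Plane where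
  toFun x := !₂[x 0 / 2, x 1]
  invFun x := !₂[2 * x 0, x 1]
  left_inv x := by
    ext i
    fin_cases i
    · simp [mul_div_cancel₀]
    · simp
  right_inv x := by
    ext i
    fin_cases i <;> simp

/-! ### Metrically quasiconformal and infinitesimally quasisymmetric maps -/

section Maps

variable {X Y : Type*} [MetricSpace X] [MetricSpace Y]

/-- The quotient `sup {d'(f x, f y) : d(x, y) ≤ r} / inf {d'(f x, f y) : d(x, y) ≥ r}`. -/
def metricDilatation (f : X → Y) (x : X) (r : ℝ) : ℝ≥0∞ :=
  (⨆ (y : X) (_ : dist x y ≤ r), edist (f x) (f y)) /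
    (⨅ (y : X) (_ : r ≤ dist x y), edist (f x) (f y))

/-- `f` is metrically quasiconformal (MQC) with constant `H`. -/
def IsMQCWith (H : ℝ≥0) (f : X → Y) : Prop :=
  IsHomeomorph f ∧ ∀ x : X, limsup (metricDilatation f x) (𝓝[>] (0 : ℝ)) ≤ H

/-- `f` is metrically quasiconformal (MQC). -/
def IsMQC (f : X → Y) : Prop := ∃ H : ℝ≥0, 1 ≤ H ∧ IsMQCWith H f

/-- `f` is infinitesimally quasisymmetric (I-QS). The scale `r` may depend on the point `x`, while
the homeomorphism `η` of `[0,∞)` may not. -/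
def IsIQS (f : X → Y) : Prop :=
  IsHomeomorph f ∧ ∃ η : ℝ≥0 ≃ₜ ℝ≥0, ∀ x : X, ∃ r : ℝ, 0 < r ∧
    ∀ y ∈ Metric.ball x r, ∀ z ∈ Metric.ball x r, x ≠ y → x ≠ z → y ≠ z →
      ∀ t : ℝ≥0, nndist x y / nndist x z ≤ t →
        nndist (f x) (f y) / nndist (f x) (f z) ≤ η t

end Maps

/-! ### Conformal modulus and geometrically quasiconformal maps -/

section Modulus

variable {X Y : Type*} [MetricSpace X] [MeasurableSpace X] [BorelSpace X]
  [MetricSpace Y] [MeasurableSpace Y] [BorelSpace Y]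

/-- A curve: the image of a continuous map from a (nonempty, possibly open, unbounded or
degenerate) interval. -/
def IsCurve (C : Set X) : Prop :=
  ∃ (I : Set ℝ) (γ : ℝ → X), I.OrdConnected ∧ I.Nonempty ∧ ContinuousOn γ I ∧ C = γ '' I

/-- The `2`-dimensional Hausdorff measure with the normalization `π 2⁻² diam²`. (The
`1`-dimensional one has the normalization `2 · 2⁻¹ diam = diam` and is `μH[1]`.) -/
def hausdorffTwo (X : Type*) [MetricSpace X] [MeasurableSpace X] [BorelSpace X] : Measure X :=
  ENNReal.ofReal (Real.pi / 4) • μH[2]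

/-- `C` has locally finite `1`-dimensional Hausdorff measure. -/
def HasLocallyFiniteLength (C : Set X) : Prop :=
  ∀ x ∈ C, ∃ U ∈ 𝓝 x, (μH[1] : Measure X) (C ∩ U) < ⊤

/-- The Borel function `ρ` is admissible for the curve family `Γ`. -/
def IsAdmissible (Γ : Set (Set X)) (ρ : X → ℝ≥0∞) : Prop :=
  Measurable ρ ∧ ∀ C ∈ Γ, HasLocallyFiniteLength C → 1 ≤ ∫⁻ x in C, ρ x ∂μH[1]

/-- The conformal modulus of a curve family. -/
def conformalModulus (Γ : Set (Set X)) : ℝ≥0∞ :=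
  ⨅ (ρ : X → ℝ≥0∞) (_ : IsAdmissible Γ ρ), ∫⁻ x, ρ x ^ 2 ∂(hausdorffTwo X)

/-- `f` is geometrically `K`-quasiconformal. -/
def IsQCWith (K : ℝ≥0) (f : X → Y) : Prop :=
  IsHomeomorph f ∧ 1 ≤ K ∧ ∀ Γ : Set (Set X), (∀ C ∈ Γ, IsCurve C) →
    (K : ℝ≥0∞)⁻¹ * conformalModulus Γ ≤ conformalModulus ((fun C => f '' C) '' Γ) ∧
      conformalModulus ((fun C => f '' C) '' Γ) ≤ K * conformalModulus Γ

end Modulus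

end

noncomputable section

/-! ### Local comparison of the two distances -/

/-! Write `ψ(r) = e^{-1/r}`, which is `expNegInvGlue`. Two facts about `d` carry everything. At the
origin, `ω` is the radial derivative of `ψ`, so `d(0, y) = ψ(|y|)` (`weightedEDist_zero_left`) and
balls about `0` are the same sets in both metrics. Elsewhere `ω` is continuous and positive, so near
`x₀` the metric `d` is `ω(x₀)` times the Euclidean one up to a factor close to `1`
(`exists_local_bounds`). Together they give (a).

For (b), the local comparison shows that `μH[s]` of the weighted plane has density `ω ^ s`
(`hausdorffMeasure_image_iotaMap`). Replacing `ρ` by `ω · (ρ ∘ ι)` thus preserves both line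
integrals (`s = 1`) and the energy (`s = 2`). The one obstacle is a curve through `0` that is
locally rectifiable for `d` only; a small extra density near `0` takes care of it
(`image_conformalModulus_le`).

The negative statements come from the failure of doubling for `ψ`: the ratio `ψ(r) / ψ(r/2) =
e^{1/r}` is unbounded. This gives (c) directly, and (e) because `h` takes the circle of radius `r`
to an ellipse with semi-axes `r/2` and `r`. For (d) the linear distortion acts on the Euclidean
side, where it costs only a factor `2`. -/

theorem weight_zero : weight 0 = 0 := if_pos rfl

theorem weight_pos {x : Plane} (hx : x ≠ 0) : 0 < weight x := by
  have := norm_pos_iff.2 hx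
  rw [weight, if_neg hx]
  positivity

theorem continuousAt_weight {x : Plane} (hx : x ≠ 0) : ContinuousAt weight x := by
  have hx' : ‖x‖ ≠ 0 := norm_ne_zero_iff.2 hx
  have h : ContinuousAt (fun z : Plane => Real.exp (-(1 / ‖z‖)) / ‖z‖ ^ 2) x := by
    refine ContinuousAt.div ?_ ?_ (pow_ne_zero _ hx')
    · exact Real.continuous_exp.continuousAt.comp
        ((continuousAt_const.div continuous_norm.continuousAt hx').neg)
    · fun_prop
  refine h.congr ?_
  filter_upwards [isOpen_ne.mem_nhds hx] with z hz
  rw [weight, if_neg hz]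

theorem measurable_weight : Measurable weight := by
  unfold weight
  refine Measurable.ite (measurableSet_singleton 0) measurable_const ?_
  fun_prop

theorem isACPath_segment (x y : Plane) : IsACPath (fun t : ℝ => x + t • (y - x)) x y := by
  refine ⟨ContDiffOn.absolutelyContinuousOnInterval (ContDiff.contDiffOn ?_), by simp, by simp⟩
  fun_prop

theorem deriv_segment (x y : Plane) (t : ℝ) :
    deriv (fun t : ℝ => x + t • (y - x)) t = y - x := by
  have : HasDerivAt (fun t : ℝ => x + t • (y - x)) (y - x) t := by
    simpa using ((hasDerivAt_id t).smul_const (y - x)).const_add x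
  exact this.deriv

theorem weightedEDist_le_of_weight_le {x y : Plane} {M : ℝ}
    (hM : ∀ z ∈ segment ℝ x y, weight z ≤ M) :
    weightedEDist x y ≤ ENNReal.ofReal (M * dist x y) := by
  refine (weightedEDist_le (isACPath_segment x y)).trans ?_
  have : weightedLength (fun t : ℝ => x + t • (y - x)) ≤
      ∫⁻ _ in Icc (0 : ℝ) 1, ENNReal.ofReal (M * dist x y) := by
    refine setLIntegral_mono' measurableSet_Icc fun t ht => ENNReal.ofReal_le_ofReal ?_
    rw [deriv_segment, dist_comm, dist_eq_norm]
    refine mul_le_mul_of_nonneg_right (hM _ ?_) (norm_nonneg _)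
    rw [segment_eq_image']
    exact ⟨t, ht, rfl⟩
  simpa using this

/-- Test `d` against the tent of slope `c` and radius `δ` centred at `x`. It is constant outside the
ball, so a path leaving the ball is only known to cost `c * δ`; hence the `min`. -/
theorem le_weightedEDist_of_le_weight {x : Plane} {c δ : ℝ} (hc : 0 ≤ c)
    (hw : ∀ z ∈ Metric.closedBall x δ, c ≤ weight z) (hδ : 0 ≤ δ) (y : Plane) :
    ENNReal.ofReal (c * min δ (dist x y)) ≤ weightedEDist x y := by
  lift c to ℝ≥0 using hc
  have hlip : LipschitzWith c (fun z => max ((c : ℝ) * (δ - dist z x)) 0) := by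
    refine LipschitzWith.max_const (LipschitzWith.of_dist_le_mul fun z w => ?_) 0
    rw [Real.dist_eq, ← mul_sub, abs_mul, abs_of_nonneg c.coe_nonneg]
    gcongr
    rw [show δ - dist z x - (δ - dist w x) = dist w x - dist z x by ring, abs_sub_comm]
    exact abs_dist_sub_le _ _ _
  have h := ofReal_sub_le_weightedEDist hlip (fun z => ?_) y x
  · rw [weightedEDist_comm]
    refine le_trans (ENNReal.ofReal_le_ofReal ?_) h
    rw [dist_self, sub_zero, dist_comm y x, max_eq_left (by positivity)]
    rcases le_total δ (dist x y) with h' | h'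
    · rw [min_eq_left h', max_eq_right (mul_nonpos_of_nonneg_of_nonpos c.coe_nonneg (by linarith)),
        sub_zero]
    · rw [min_eq_right h', max_eq_left (mul_nonneg c.coe_nonneg (by linarith))]
      linarith
  · by_cases hz : z ∈ Metric.closedBall x δ
    · exact Or.inl (hw z hz)
    · refine Or.inr ⟨0, ?_⟩
      filter_upwards [Metric.isClosed_closedBall.isOpen_compl.mem_nhds hz] with w hw
      rw [mem_compl_iff, Metric.mem_closedBall, not_le] at hw
      exact max_eq_right (mul_nonpos_of_nonneg_of_nonpos c.coe_nonneg (by linarith))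

/-- Away from the origin, `d` is locally `ω(x)` times the Euclidean distance, up to a factor
arbitrarily close to `1`. -/
theorem exists_local_bounds {x₀ : Plane} (h₀ : x₀ ≠ 0) {t : ℝ} (ht : 1 < t) :
    ∃ δ > 0, (∀ x ∈ Metric.ball x₀ δ, weight x₀ / t ≤ weight x ∧ weight x ≤ t * weight x₀) ∧
      (∀ x ∈ Metric.ball x₀ δ, ∀ y ∈ Metric.ball x₀ δ,
        weightedEDist x y ≤ ENNReal.ofReal (t * weight x₀ * dist x y)) ∧
      ∀ x ∈ Metric.ball x₀ δ, ∀ y,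
        ENNReal.ofReal (weight x₀ / t * min (2 * δ) (dist x y)) ≤ weightedEDist x y := by
  have hw := weight_pos h₀
  have ht0 : 0 < t := by linarith
  have hev : ∀ᶠ x in 𝓝 x₀, weight x ∈ Ioo (weight x₀ / t) (t * weight x₀) := by
    refine (continuousAt_weight h₀).eventually (Ioo_mem_nhds (div_lt_self hw ht) ?_)
    nlinarith
  obtain ⟨r, hr, H⟩ := Metric.eventually_nhds_iff_ball.1 hev
  have H1 : ∀ x ∈ Metric.ball x₀ (r / 3),
      weight x₀ / t ≤ weight x ∧ weight x ≤ t * weight x₀ := fun x hx =>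
    have := H x (Metric.ball_subset_ball (by linarith) hx)
    ⟨this.1.le, this.2.le⟩
  -- With `δ = r / 3`, the `2δ`-ball about any point of the `δ`-ball stays inside the `r`-ball.
  -- Since `2δ` bounds the diameter of the `δ`-ball, the `min` disappears for pairs of its points.
  refine ⟨r / 3, by positivity, H1, fun x hx y hy => ?_, fun x hx y => ?_⟩
  · exact weightedEDist_le_of_weight_le fun z hz =>
      (H1 z ((convex_ball x₀ (r / 3)).segment_subset hx hy hz)).2
  · refine le_weightedEDist_of_le_weight (by positivity) (fun z hz => ?_) (by positivity) y
    refine (H z ?_).1.le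
    rw [Metric.mem_closedBall] at hz
    rw [Metric.mem_ball] at hx ⊢
    linarith [dist_triangle z x x₀]

/-! ### The distance to the origin -/

/-- The link between `ω` and `ψ`. It includes the origin, where `ψ` is flat and `ω` vanishes. -/
theorem hasDerivAt_expNegInvGlue_norm (x : Plane) :
    HasDerivAt expNegInvGlue (weight x) ‖x‖ := by
  have h := expNegInvGlue.hasDerivAt_polynomial_eval_inv_mul 1 ‖x‖
  simp only [Polynomial.eval_one, one_mul] at h
  convert h using 1
  by_cases hx : x = 0
  · simp [hx, weight_zero]
  · have := norm_pos_iff.2 hx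
    simp [weight, hx, expNegInvGlue, div_eq_mul_inv, mul_comm]

theorem hasDerivAt_expNegInvGlue_of_nonneg {r : ℝ} (hr : 0 ≤ r) :
    ∃ w, HasDerivAt expNegInvGlue w r ∧ 0 ≤ w ∧ w ≤ 2 := by
  obtain ⟨x, hx⟩ := exists_norm_eq Plane hr
  exact ⟨weight x, hx ▸ hasDerivAt_expNegInvGlue_norm x, weight_nonneg x, weight_le_two x⟩

/-- Ensures that `ψ(|γ|)` is absolutely continuous along an absolutely continuous path, so that the
fundamental theorem of calculus applies to it. -/
theorem lipschitzWith_expNegInvGlue : LipschitzWith 2 expNegInvGlue := by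
  refine lipschitzWith_of_nnnorm_deriv_le
    ((expNegInvGlue.contDiff (n := 1)).differentiable (by norm_num)) fun r => ?_
  rw [← NNReal.coe_le_coe, coe_nnnorm]
  rcases lt_or_ge r 0 with hr | hr
  · have : expNegInvGlue =ᶠ[𝓝 r] fun _ => 0 := by
      filter_upwards [gt_mem_nhds hr] with s hs
      exact expNegInvGlue.zero_of_nonpos hs.le
    rw [this.deriv_eq]
    simp
  · obtain ⟨w, h, h0, h2⟩ := hasDerivAt_expNegInvGlue_of_nonneg hr
    rw [h.deriv, Real.norm_eq_abs, abs_of_nonneg h0]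
    exact h2

/-- The radial segment has weighted length `∫ ψ' = ψ(|y|)`. No path does better, since `ψ(|γ|)`
changes at rate at most `ω(γ) |γ'|`. -/
theorem weightedEDist_zero_left (y : Plane) :
    weightedEDist 0 y = ENNReal.ofReal (expNegInvGlue ‖y‖) := by
  refine le_antisymm ?_ (le_iInf₂ fun γ hγ => ?_)
  · refine (weightedEDist_le (isACPath_segment 0 y)).trans (le_of_eq ?_)
    have hd : ∀ t ∈ uIcc (0 : ℝ) 1, HasDerivAt (fun t => expNegInvGlue (t * ‖y‖))
        (weight (t • y) * ‖y‖) t := fun t ht => by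
      rw [uIcc_of_le zero_le_one] at ht
      have h := hasDerivAt_expNegInvGlue_norm (t • y)
      rw [norm_smul, Real.norm_eq_abs, abs_of_nonneg ht.1] at h
      have h2 : HasDerivAt (fun t => t * ‖y‖) ‖y‖ t := by
        simpa using (hasDerivAt_id t).mul_const ‖y‖
      exact h.comp t h2
    have hm : Measurable fun t : ℝ => weight (t • y) * ‖y‖ :=
      (measurable_weight.comp (by fun_prop)).mul_const _
    have hint : IntervalIntegrable (fun t : ℝ => weight (t • y) * ‖y‖) volume 0 1 := by
      refine (intervalIntegrable_const (c := 2 * ‖y‖)).mono_fun hm.aestronglyMeasurable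
        (ae_of_all _ fun t => ?_)
      have h0 := mul_nonneg (weight_nonneg (t • y)) (norm_nonneg y)
      have h2 := mul_le_mul_of_nonneg_right (weight_le_two (t • y)) (norm_nonneg y)
      simpa only [Real.norm_eq_abs, abs_of_nonneg h0, abs_of_nonneg (h0.trans h2)] using h2
    have h := intervalIntegral.integral_eq_sub_of_hasDerivAt hd hint
    rw [one_mul, zero_mul, expNegInvGlue.zero, sub_zero,
      intervalIntegral.integral_of_le zero_le_one] at h
    rw [← h, ofReal_integral_eq_lintegral_ofReal
      ((intervalIntegrable_iff_integrableOn_Ioc_of_le zero_le_one).1 hint)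
      (ae_of_all _ fun t => mul_nonneg (weight_nonneg _) (norm_nonneg _)),
      restrict_Ioc_eq_restrict_Icc]
    simp only [weightedLength, deriv_segment]
    simp
  · have hac1 : AbsolutelyContinuousOnInterval (fun t => ‖γ t‖) 0 1 :=
      acOn_comp_lipschitz hγ.ac lipschitzWith_one_norm
    have hac := acOn_comp_lipschitz hac1 lipschitzWith_expNegInvGlue
    have hint := hac.integral_deriv_eq_sub
    rw [hγ.source, hγ.target, norm_zero, expNegInvGlue.zero, sub_zero] at hint
    rw [← hint, intervalIntegral.integral_of_le zero_le_one]
    refine (ENNReal.ofReal_le_ofReal (le_abs_self _)).trans ?_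
    rw [← Real.norm_eq_abs, ofReal_norm]
    refine (enorm_integral_le_lintegral_enorm _).trans ?_
    rw [restrict_Ioc_eq_restrict_Icc]
    refine lintegral_mono_ae ?_
    rw [ae_restrict_iff' measurableSet_Icc]
    have hdiff : ∀ᵐ t, t ∈ uIcc (0 : ℝ) 1 → DifferentiableAt ℝ γ t :=
      hγ.ac.boundedVariationOn.ae_differentiableAt_of_mem_uIcc
    filter_upwards [hdiff, hac1.ae_differentiableAt] with t ht1 ht2 ht
    rw [← uIcc_of_le zero_le_one] at ht
    have d1 := (ht1 ht).hasDerivAt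
    have d2 := (ht2 ht).hasDerivAt
    have d3 : HasDerivAt (fun t => expNegInvGlue ‖γ t‖)
        (weight (γ t) * deriv (fun t => ‖γ t‖) t) t :=
      HasDerivAt.comp (h := fun t => ‖γ t‖) t (hasDerivAt_expNegInvGlue_norm (γ t)) d2
    rw [d3.deriv, ← ofReal_norm]
    refine ENNReal.ofReal_le_ofReal ?_
    rw [norm_mul, Real.norm_eq_abs, abs_of_nonneg (weight_nonneg _)]
    refine mul_le_mul_of_nonneg_left ?_ (weight_nonneg _)
    -- The derivative of `|γ|` is at most `|γ'|` in absolute value: compare difference quotients by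
    -- the reverse triangle inequality.
    have l1 := (hasDerivAt_iff_tendsto_slope.1 d1).norm
    have l2 := (hasDerivAt_iff_tendsto_slope.1 d2).norm
    refine le_of_tendsto_of_tendsto l2 l1 (Eventually.of_forall fun s => ?_)
    simp only [slope_def_module, norm_smul, smul_eq_mul, norm_mul]
    gcongr
    exact abs_norm_sub_norm_le _ _

theorem expNegInvGlue_strictMonoOn : StrictMonoOn expNegInvGlue (Ici 0) := by
  intro x hx y _ hxy
  rcases (mem_Ici.1 hx).eq_or_lt with rfl | hx0
  · simpa using expNegInvGlue.pos_of_pos hxy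
  · rw [expNegInvGlue, expNegInvGlue, if_neg (not_le.2 hx0), if_neg (not_le.2 (hx0.trans hxy))]
    gcongr

/-! ### The identity is a homeomorphism -/

theorem edist_iotaMap (x y : Plane) : edist (iotaMap x) (iotaMap y) = weightedEDist x y := by
  rw [edist_dist]
  exact ENNReal.ofReal_toReal (weightedEDist_ne_top x y)

theorem dist_iotaMap_zero (y : Plane) : dist (iotaMap 0) (iotaMap y) = expNegInvGlue ‖y‖ := by
  rw [dist_edist, edist_iotaMap, weightedEDist_zero_left,
    ENNReal.toReal_ofReal (expNegInvGlue.nonneg _)]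

theorem lipschitzWith_iotaMap : LipschitzWith 2 iotaMap := fun x y => by
  rw [edist_iotaMap]
  refine (weightedEDist_le_of_weight_le fun z _ => weight_le_two z).trans (le_of_eq ?_)
  rw [ENNReal.ofReal_mul zero_le_two, ← edist_dist]
  simp

theorem continuous_iotaMap_symm : Continuous iotaMap.symm := by
  refine continuous_iff_continuousAt.2 fun p => ?_
  obtain ⟨x, rfl⟩ := iotaMap.surjective p
  refine Metric.continuousAt_iff.2 fun ε hε => ?_
  by_cases hx : x = 0
  · subst hx
    refine ⟨expNegInvGlue ε, expNegInvGlue.pos_of_pos hε, fun q hq => ?_⟩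
    obtain ⟨y, rfl⟩ := iotaMap.surjective q
    rw [dist_comm, dist_iotaMap_zero] at hq
    rw [Equiv.symm_apply_apply, Equiv.symm_apply_apply, dist_zero_right]
    exact (expNegInvGlue_strictMonoOn.lt_iff_lt (norm_nonneg y) hε.le).1 hq
  · obtain ⟨δ, hδ, -, -, h⟩ := exists_local_bounds hx one_lt_two
    have hw := weight_pos hx
    -- This threshold forces `min (2δ) |x - y| < min (2δ) ε`, hence `|x - y| < ε`.
    refine ⟨weight x / 2 * min (2 * δ) ε, by positivity, fun q hq => ?_⟩
    obtain ⟨y, rfl⟩ := iotaMap.surjective q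
    rw [Equiv.symm_apply_apply, Equiv.symm_apply_apply, dist_comm]
    have h1 := h x (Metric.mem_ball_self hδ) y
    rw [← edist_iotaMap, edist_dist, ENNReal.ofReal_le_ofReal_iff dist_nonneg,
      dist_comm (iotaMap x)] at h1
    have h2 := lt_of_mul_lt_mul_left (h1.trans_lt hq) (by positivity)
    by_contra! h3
    exact h2.not_ge (min_le_min_left _ h3)

/-- The identity as a homeomorphism. -/
def iotaHomeo : Plane ≃ₜ WeightedPlane where
  toEquiv := iotaMap
  continuous_toFun := lipschitzWith_iotaMap.continuous
  continuous_invFun := continuous_iotaMap_symm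

/-- The linear map `h` as a homeomorphism. -/
def halfHomeo : Plane ≃ₜ Plane where
  toEquiv := halfMap
  continuous_toFun := by
    change Continuous fun x : Plane => (!₂[x 0 / 2, x 1] : Plane)
    fun_prop
  continuous_invFun := by
    change Continuous fun x : Plane => (!₂[2 * x 0, x 1] : Plane)
    fun_prop

/-! ### Hausdorff measures of the weighted plane -/

/-- By the Lindelöf property countably many of the `U` cover `A`; make them disjoint and sum. No
finiteness is involved, which matters because `μH[1]` on the plane is not σ-finite. -/
theorem measure_le_of_locally_le {X : Type*} [TopologicalSpace X] [SecondCountableTopology X]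
    [MeasurableSpace X] [OpensMeasurableSpace X] {μ ν : Measure X} {A : Set X}
    (hA : MeasurableSet A) (h : ∀ x ∈ A, ∃ U : Set X, IsOpen U ∧ x ∈ U ∧
      ∀ B ⊆ U, MeasurableSet B → μ B ≤ ν B) : μ A ≤ ν A := by
  choose! U hUo hxU hU using h
  obtain ⟨T, hTA, hTc, hcov⟩ := TopologicalSpace.countable_cover_nhdsWithin (s := A) (f := U)
    fun x hx => mem_nhdsWithin_of_mem_nhds ((hUo x hx).mem_nhds (hxU x hx))
  rcases T.eq_empty_or_nonempty with rfl | hT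
  · have : A = ∅ := by simpa using hcov
    simp [this]
  obtain ⟨f, rfl⟩ := hTc.exists_eq_range hT
  have hfA : ∀ n, f n ∈ A := fun n => hTA (mem_range_self n)
  have hAeq : A = ⋃ n, A ∩ disjointed (fun n => U (f n)) n := by
    rw [← inter_iUnion, iUnion_disjointed]
    refine (inter_eq_left.2 ?_).symm
    simpa using hcov
  have hm : ∀ n, MeasurableSet (A ∩ disjointed (fun n => U (f n)) n) := fun n =>
    hA.inter (MeasurableSet.disjointed (fun n => (hUo _ (hfA n)).measurableSet) n)
  have hd : Pairwise (Function.onFun Disjoint fun n => A ∩ disjointed (fun n => U (f n)) n) :=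
    fun i j hij => (disjoint_disjointed _ hij).mono inter_subset_right inter_subset_right
  rw [hAeq, measure_iUnion hd hm, measure_iUnion hd hm]
  exact ENNReal.tsum_le_tsum fun n =>
    hU _ (hfA n) _ (inter_subset_right.trans (disjointed_subset _ n)) (hm n)

theorem le_of_forall_le_rpow_mul {x y : ℝ≥0∞} (s : ℝ)
    (h : ∀ t : ℝ, 1 < t → x ≤ ENNReal.ofReal (t ^ 2) ^ s * y) : x ≤ y := by
  have hc : Continuous fun t : ℝ => ENNReal.ofReal (t ^ 2) ^ s :=
    ENNReal.continuous_rpow_const.comp (ENNReal.continuous_ofReal.comp (continuous_pow 2))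
  have h1 : Tendsto (fun t : ℝ => ENNReal.ofReal (t ^ 2) ^ s) (𝓝[>] 1) (𝓝 1) := by
    simpa using (hc.tendsto 1).mono_left nhdsWithin_le_nhds
  have h2 := ENNReal.Tendsto.mul_const (b := y) h1 (Or.inl one_ne_zero)
  rw [one_mul] at h2
  exact ge_of_tendsto h2 (eventually_mem_nhdsWithin.mono h)

/-- The weight as an extended nonnegative function. -/
def eweight (x : Plane) : ℝ≥0∞ := ENNReal.ofReal (weight x)

theorem measurable_eweight : Measurable eweight := measurable_weight.ennreal_ofReal

theorem eweight_ne_top (x : Plane) : eweight x ≠ ⊤ := ENNReal.ofReal_ne_top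

theorem eweight_ne_zero {x : Plane} (hx : x ≠ 0) : eweight x ≠ 0 :=
  (ENNReal.ofReal_pos.2 (weight_pos hx)).ne'

theorem lipschitzOnWith_iotaMap {B : Set Plane} {M : ℝ}
    (h : ∀ x ∈ B, ∀ y ∈ B, weightedEDist x y ≤ ENNReal.ofReal (M * dist x y)) (hM : 0 ≤ M) :
    LipschitzOnWith M.toNNReal iotaMap B := fun x hx y hy => by
  rw [edist_iotaMap]
  refine (h x hx y hy).trans (le_of_eq ?_)
  rw [ENNReal.ofReal_mul hM, ← edist_dist]
  rfl

theorem lipschitzOnWith_iotaMap_symm {B : Set Plane} {m : ℝ} (hm : 0 < m)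
    (h : ∀ x ∈ B, ∀ y ∈ B, ENNReal.ofReal (m * dist x y) ≤ weightedEDist x y) :
    LipschitzOnWith m⁻¹.toNNReal iotaMap.symm (iotaMap '' B) := by
  rintro _ ⟨x, hx, rfl⟩ _ ⟨y, hy, rfl⟩
  rw [edist_iotaMap, Equiv.symm_apply_apply, Equiv.symm_apply_apply]
  calc edist x y = ENNReal.ofReal (m⁻¹ * (m * dist x y)) := by
        rw [inv_mul_cancel_left₀ hm.ne', ← edist_dist]
    _ = ENNReal.ofReal m⁻¹ * ENNReal.ofReal (m * dist x y) :=
        ENNReal.ofReal_mul (inv_pos.2 hm).le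
    _ ≤ _ := mul_le_mul' le_rfl (h x hx y hy)

/-- On a small ball both the stretching of `ι` and the values of `ω` lie between `ω(x₀) / t` and `t
ω(x₀)`. The quotient of these bounds is the error `t ^ 2`, later sent to `1`. -/
theorem exists_local_measure_bounds {s : ℝ} (hs : 0 < s) {x₀ : Plane} (h₀ : x₀ ≠ 0) {t : ℝ}
    (ht : 1 < t) :
    ∃ U : Set Plane, IsOpen U ∧ x₀ ∈ U ∧ ∀ B ⊆ U, MeasurableSet B →
      μH[s] (iotaMap '' B) ≤ ENNReal.ofReal (t ^ 2) ^ s * ∫⁻ x in B, eweight x ^ s ∂μH[s] ∧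
      ∫⁻ x in B, eweight x ^ s ∂μH[s] ≤ ENNReal.ofReal (t ^ 2) ^ s * μH[s] (iotaMap '' B) := by
  obtain ⟨δ, hδ, hw, hup, hlow⟩ := exists_local_bounds h₀ ht
  have hw0 := weight_pos h₀
  have ht0 : 0 < t := by linarith
  have hpow : ∀ {a b : ℝ}, 0 ≤ a →
      ENNReal.ofReal (a * b) ^ s = ENNReal.ofReal a ^ s * ENNReal.ofReal b ^ s := fun ha => by
    rw [ENNReal.ofReal_mul ha, ENNReal.mul_rpow_of_nonneg _ _ hs.le]
  refine ⟨Metric.ball x₀ δ, Metric.isOpen_ball, Metric.mem_ball_self hδ, fun B hB hBm => ?_⟩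
  have hL := lipschitzOnWith_iotaMap (fun x hx y hy => hup x (hB hx) y (hB hy)) (by positivity)
  have hR : LipschitzOnWith (weight x₀ / t)⁻¹.toNNReal iotaMap.symm (iotaMap '' B) := by
    refine lipschitzOnWith_iotaMap_symm (by positivity) fun x hx y hy => ?_
    have := hlow x (hB hx) y
    have hxy := dist_triangle_right x y x₀
    rwa [min_eq_right] at this
    linarith [Metric.mem_ball.1 (hB hx), Metric.mem_ball.1 (hB hy)]
  have hL' := hL.hausdorffMeasure_image_le hs.le
  have hR' := hR.hausdorffMeasure_image_le hs.le
  rw [Equiv.symm_image_image] at hR'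
  change μH[s] (iotaMap '' B) ≤ ENNReal.ofReal (t * weight x₀) ^ s * μH[s] B at hL'
  change μH[s] B ≤ ENNReal.ofReal (weight x₀ / t)⁻¹ ^ s * μH[s] (iotaMap '' B) at hR'
  have hI1 : ENNReal.ofReal (weight x₀ / t) ^ s * μH[s] B ≤ ∫⁻ x in B, eweight x ^ s ∂μH[s] := by
    rw [← setLIntegral_const]
    exact setLIntegral_mono' hBm fun x hx =>
      ENNReal.rpow_le_rpow (ENNReal.ofReal_le_ofReal (hw x (hB hx)).1) hs.le
  have hI2 : ∫⁻ x in B, eweight x ^ s ∂μH[s] ≤ ENNReal.ofReal (t * weight x₀) ^ s * μH[s] B := by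
    rw [← setLIntegral_const]
    exact setLIntegral_mono' hBm fun x hx =>
      ENNReal.rpow_le_rpow (ENNReal.ofReal_le_ofReal (hw x (hB hx)).2) hs.le
  constructor
  · refine hL'.trans ?_
    rw [show t * weight x₀ = t ^ 2 * (weight x₀ / t) by field_simp, hpow (by positivity), mul_assoc]
    gcongr
  · refine hI2.trans ?_
    have e : t ^ 2 = (t * weight x₀) * (weight x₀ / t)⁻¹ := by field_simp
    rw [e, hpow (a := t * weight x₀) (by positivity), mul_assoc]
    gcongr

theorem measurableSet_image_iotaMap {A : Set Plane} (hA : MeasurableSet A) :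
    MeasurableSet (iotaMap '' A) :=
  iotaHomeo.measurableEmbedding.measurableSet_image' hA

/-- The Hausdorff measure `μH[s]` of the weighted plane has density `ω ^ s` with respect to the
Euclidean one. -/
theorem hausdorffMeasure_image_iotaMap {s : ℝ} (hs : 0 < s) {A : Set Plane}
    (hA : MeasurableSet A) :
    μH[s] (iotaMap '' A) = ∫⁻ x in A, eweight x ^ s ∂μH[s] := by
  have := Measure.nullSingletonClass_hausdorff WeightedPlane hs
  have := Measure.nullSingletonClass_hausdorff Plane hs
  have key : ∀ B : Set Plane, MeasurableSet B →
      μH[s].map iotaHomeo.symm B = μH[s] (iotaMap '' B) := fun B hB => by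
    rw [Measure.map_apply iotaHomeo.symm.continuous.measurable hB]
    exact congrArg _ (iotaMap.image_eq_preimage_symm B).symm
  have key' : ∀ B : Set Plane, MeasurableSet B →
      μH[s].withDensity (fun x => eweight x ^ s) B = ∫⁻ x in B, eweight x ^ s ∂μH[s] :=
    fun B hB => withDensity_apply _ hB
  -- The local bounds are unavailable at the origin, but for `s > 0` a point is null for both
  -- measures.
  have hA0 : MeasurableSet (A \ {0}) := hA.diff (measurableSet_singleton 0)
  have e1 : μH[s] (iotaMap '' A) = μH[s].map iotaHomeo.symm (A \ {0}) := by
    rw [key _ hA0, image_sdiff iotaMap.injective, image_singleton,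
      measure_sdiff_null (measure_singleton _)]
  have e2 : ∫⁻ x in A, eweight x ^ s ∂μH[s] =
      μH[s].withDensity (fun x => eweight x ^ s) (A \ {0}) := by
    rw [← key' _ hA, measure_sdiff_null]
    exact withDensity_absolutelyContinuous _ _ (measure_singleton _)
  rw [e1, e2]
  refine le_antisymm ?_ ?_ <;> refine le_of_forall_le_rpow_mul s fun t ht => ?_
  · rw [← smul_eq_mul, ← Measure.smul_apply]
    refine measure_le_of_locally_le hA0 fun x hx => ?_
    obtain ⟨U, hU, hxU, H⟩ := exists_local_measure_bounds hs hx.2 ht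
    refine ⟨U, hU, hxU, fun B hB hBm => ?_⟩
    rw [Measure.smul_apply, smul_eq_mul, key _ hBm, key' _ hBm]
    exact (H B hB hBm).1
  · rw [← smul_eq_mul, ← Measure.smul_apply]
    refine measure_le_of_locally_le hA0 fun x hx => ?_
    obtain ⟨U, hU, hxU, H⟩ := exists_local_measure_bounds hs hx.2 ht
    refine ⟨U, hU, hxU, fun B hB hBm => ?_⟩
    rw [Measure.smul_apply, smul_eq_mul, key _ hBm, key' _ hBm]
    exact (H B hB hBm).2

theorem hausdorffMeasure_eq_map {s : ℝ} (hs : 0 < s) :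
    (μH[s] : Measure WeightedPlane) =
      (μH[s].withDensity fun x => eweight x ^ s).map iotaMap := by
  have hm : Measurable iotaMap := lipschitzWith_iotaMap.continuous.measurable
  ext A hA
  rw [Measure.map_apply hm hA, withDensity_apply _ (hm hA),
    ← hausdorffMeasure_image_iotaMap hs (hm hA), image_preimage_eq _ iotaMap.surjective]

theorem lintegral_image_iotaMap {s : ℝ} (hs : 0 < s) {A : Set Plane} (hA : MeasurableSet A)
    {ρ : WeightedPlane → ℝ≥0∞} (hρ : Measurable ρ) :
    ∫⁻ p in iotaMap '' A, ρ p ∂μH[s] = ∫⁻ x in A, eweight x ^ s * ρ (iotaMap x) ∂μH[s] := by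
  have hm : Measurable iotaMap := lipschitzWith_iotaMap.continuous.measurable
  rw [hausdorffMeasure_eq_map hs, setLIntegral_map (measurableSet_image_iotaMap hA) hρ hm,
    preimage_image_eq _ iotaMap.injective, restrict_withDensity hA,
    lintegral_withDensity_eq_lintegral_mul _ (measurable_eweight.pow_const s)
      (g := fun x => ρ (iotaMap x)) (hρ.comp hm)]
  rfl

theorem lintegral_hausdorffTwo_weightedPlane {ρ : WeightedPlane → ℝ≥0∞} (hρ : Measurable ρ) :
    ∫⁻ p, ρ p ∂hausdorffTwo WeightedPlane =
      ∫⁻ x, eweight x ^ 2 * ρ (iotaMap x) ∂hausdorffTwo Plane := by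
  have h := lintegral_image_iotaMap zero_lt_two MeasurableSet.univ hρ
  rw [image_univ, iotaMap.surjective.range_eq, setLIntegral_univ, setLIntegral_univ] at h
  simp only [hausdorffTwo, lintegral_smul_measure, h, ENNReal.rpow_two]

/-! ### Curves -/

/-- Every interval is locally closed in `ℝ`, hence locally compact and second countable. This makes
curves countable unions of compact sets, so Borel, as the change of variables demands. -/
theorem Set.OrdConnected.isSigmaCompact_real {I : Set ℝ} (hI : I.OrdConnected) :
    IsSigmaCompact I := by
  have hlc : IsLocallyClosed I := by
    rcases hI.isPreconnected.mem_intervals with h | h | h | h | h | h | h | h | h | h <;> rw [h]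
    · exact isClosed_Icc.isLocallyClosed
    · exact isLocallyClosed_Ico
    · exact isLocallyClosed_Ioc
    · exact isOpen_Ioo.isLocallyClosed
    · exact isClosed_Ici.isLocallyClosed
    · exact isOpen_Ioi.isLocallyClosed
    · exact isClosed_Iic.isLocallyClosed
    · exact isOpen_Iio.isLocallyClosed
    · exact isOpen_univ.isLocallyClosed
    · exact isOpen_empty.isLocallyClosed
  have := hlc.locallyCompactSpace
  exact isSigmaCompact_iff_sigmaCompactSpace.2 inferInstance

theorem IsCurve.measurableSet {X : Type*} [MetricSpace X] [MeasurableSpace X] [BorelSpace X]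
    {C : Set X} (hC : IsCurve C) : MeasurableSet C := by
  obtain ⟨I, γ, hI, -, hγ, rfl⟩ := hC
  obtain ⟨K, hK, hU⟩ := hI.isSigmaCompact_real.image_of_continuousOn hγ
  rw [← hU]
  exact MeasurableSet.iUnion fun n => (hK n).measurableSet

theorem HasLocallyFiniteLength.image_iotaMap {C : Set Plane} (h : HasLocallyFiniteLength C) :
    HasLocallyFiniteLength (iotaMap '' C) := by
  rintro _ ⟨x, hx, rfl⟩
  obtain ⟨U, hU, hfin⟩ := h x hx
  refine ⟨iotaMap '' U, iotaHomeo.isOpenMap.image_mem_nhds hU, ?_⟩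
  rw [← image_inter iotaMap.injective]
  refine (lipschitzWith_iotaMap.hausdorffMeasure_image_le zero_le_one _).trans_lt ?_
  exact ENNReal.mul_lt_top (by simp) hfin

/-- If the image of `C` has locally finite length, then `C` has locally finite length away from
the origin. -/
theorem HasLocallyFiniteLength.of_image_iotaMap {C : Set Plane}
    (h : HasLocallyFiniteLength (iotaMap '' C)) {x : Plane} (hx : x ∈ C) (h0 : x ≠ 0) :
    ∃ U ∈ 𝓝 x, (μH[1] : Measure Plane) (C ∩ U) < ⊤ := by
  obtain ⟨V, hV, hfin⟩ := h _ (mem_image_of_mem _ hx)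
  obtain ⟨δ, hδ, -, -, hlow⟩ := exists_local_bounds h0 one_lt_two
  have hw := weight_pos h0
  refine ⟨iotaMap ⁻¹' V ∩ Metric.ball x δ, inter_mem
    (lipschitzWith_iotaMap.continuous.continuousAt hV) (Metric.ball_mem_nhds x hδ), ?_⟩
  have hR : LipschitzOnWith (weight x / 2)⁻¹.toNNReal iotaMap.symm
      (iotaMap '' (C ∩ (iotaMap ⁻¹' V ∩ Metric.ball x δ))) := by
    refine lipschitzOnWith_iotaMap_symm (by positivity) fun y hy z hz => ?_
    have := hlow y hy.2.2 z
    have hyz := dist_triangle_right y z x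
    rwa [min_eq_right] at this
    linarith [Metric.mem_ball.1 hy.2.2, Metric.mem_ball.1 hz.2.2]
  have hR' := hR.hausdorffMeasure_image_le zero_le_one
  rw [Equiv.symm_image_image] at hR'
  refine hR'.trans_lt (ENNReal.mul_lt_top (by simp) (lt_of_le_of_lt (measure_mono ?_) hfin))
  rintro _ ⟨y, hy, rfl⟩
  exact ⟨mem_image_of_mem _ hy.1, hy.2.1⟩

/-! ### The modulus -/

/-- Pull `ρ` back to `ω · (ρ ∘ ι)`. Admissibility transfers because `ι` is Lipschitz and so
preserves locally finite length, even at the origin. -/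
theorem conformalModulus_le_image {Γ : Set (Set Plane)} (hΓ : ∀ C ∈ Γ, IsCurve C) :
    conformalModulus Γ ≤ conformalModulus ((fun C => iotaMap '' C) '' Γ) := by
  refine le_iInf₂ fun ρ hρ => ?_
  have hm : Measurable iotaMap := lipschitzWith_iotaMap.continuous.measurable
  refine iInf₂_le_of_le (fun x => eweight x * ρ (iotaMap x))
    ⟨measurable_eweight.mul (hρ.1.comp hm), fun C hC hfin => ?_⟩ ?_
  · refine (hρ.2 _ (mem_image_of_mem _ hC) hfin.image_iotaMap).trans (le_of_eq ?_)
    rw [lintegral_image_iotaMap one_pos (hΓ C hC).measurableSet hρ.1]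
    simp only [ENNReal.rpow_one]
  · rw [lintegral_hausdorffTwo_weightedPlane (hρ.1.pow_const 2)]
    simp only [mul_pow, le_refl]

theorem hausdorffTwo_ball_lt_top (x : Plane) (r : ℝ) :
    hausdorffTwo Plane (Metric.ball x r) < ⊤ := by
  have : (μH[2] : Measure Plane).IsAddHaarMeasure := by
    simpa using isAddHaarMeasure_hausdorffMeasure (E := Plane)
  rw [hausdorffTwo, Measure.smul_apply, smul_eq_mul]
  exact ENNReal.mul_lt_top ENNReal.ofReal_lt_top measure_ball_lt_top

/-- Pushing `ρ` forward to `ρ / ω` need not be admissible: a curve may gain locally finite length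
under `ι`, on which `ρ` was unconstrained. Such a curve has infinite Euclidean length in the unit
ball, so raising `ρ` to at least `ε` there gives it infinite integral, at an energy cost `O(ε²)`. -/
theorem image_conformalModulus_le {Γ : Set (Set Plane)} (hΓ : ∀ C ∈ Γ, IsCurve C) :
    conformalModulus ((fun C => iotaMap '' C) '' Γ) ≤ conformalModulus Γ := by
  refine le_iInf₂ fun ρ hρ => ?_
  set B : Set Plane := Metric.ball 0 1 with hB
  have hsm : Measurable iotaMap.symm := continuous_iotaMap_symm.measurable
  have hBm : MeasurableSet B := Metric.isOpen_ball.measurableSet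
  have step : ∀ ε : ℝ≥0, 0 < ε →
      conformalModulus ((fun C => iotaMap '' C) '' Γ) ≤
        ∫⁻ x, ρ x ^ 2 ∂hausdorffTwo Plane + ε ^ 2 * hausdorffTwo Plane B := by
    intro ε hε
    set g : Plane → ℝ≥0∞ := fun x => max (ρ x) (B.indicator (fun _ => (ε : ℝ≥0∞)) x) with hg
    have hgm : Measurable g := hρ.1.max (measurable_const.indicator hBm)
    have hσm : Measurable fun p : WeightedPlane => g (iotaMap.symm p) / eweight (iotaMap.symm p) :=
      (hgm.comp hsm).div (measurable_eweight.comp hsm)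
    have hcancel : ∀ x ≠ 0, eweight x * (g x / eweight x) = g x := fun x hx =>
      ENNReal.mul_div_cancel (eweight_ne_zero hx) (eweight_ne_top x)
    refine iInf₂_le_of_le (fun p => g (iotaMap.symm p) / eweight (iotaMap.symm p))
      ⟨hσm, ?_⟩ ?_
    · rintro _ ⟨C, hC, rfl⟩ hfin
      have hCm := (hΓ C hC).measurableSet
      have := Measure.nullSingletonClass_hausdorff Plane one_pos
      rw [lintegral_image_iotaMap one_pos hCm hσm]
      have hae : ∫⁻ x in C, eweight x ^ (1 : ℝ) * (g (iotaMap.symm (iotaMap x)) /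
          eweight (iotaMap.symm (iotaMap x))) ∂μH[1] = ∫⁻ x in C, g x ∂μH[1] := by
        refine lintegral_congr_ae (ae_restrict_of_ae ?_)
        filter_upwards [compl_mem_ae_iff.2 (measure_singleton (0 : Plane))] with x hx
        rw [ENNReal.rpow_one, Equiv.symm_apply_apply]
        exact hcancel x hx
      rw [hae]
      by_cases hCf : HasLocallyFiniteLength C
      · exact (hρ.2 C hC hCf).trans (lintegral_mono fun x => le_max_left _ _)
      -- Were this finite, `B` would witness local finiteness at `0`, and the image supplies it at
      -- every other point.
      · have htop : μH[1] (C ∩ B) = ⊤ := by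
          by_contra hne
          refine hCf fun x hx => ?_
          by_cases h0 : x = 0
          · exact ⟨B, h0 ▸ Metric.ball_mem_nhds 0 one_pos, Ne.lt_top hne⟩
          · exact hfin.of_image_iotaMap hx h0
        have : ∫⁻ x in C, B.indicator (fun _ => (ε : ℝ≥0∞)) x ∂μH[1] = ⊤ := by
          rw [lintegral_indicator hBm, setLIntegral_const, Measure.restrict_apply hBm, inter_comm,
            htop, ENNReal.mul_top (by simpa using hε.ne')]
        refine le_trans ?_ (lintegral_mono fun x => le_max_right _ _)
        rw [this]
        exact le_top
    · rw [lintegral_hausdorffTwo_weightedPlane (hσm.pow_const 2)]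
      calc _ ≤ ∫⁻ x, (ρ x ^ 2 + B.indicator (fun _ => (ε : ℝ≥0∞) ^ 2) x) ∂hausdorffTwo Plane := by
            refine lintegral_mono fun x => ?_
            rw [← mul_pow, Equiv.symm_apply_apply]
            -- As an inequality this holds at the origin too, where `eweight` is `0` and so is the
            -- product.
            have h1 : (eweight x * (g x / eweight x)) ^ 2 ≤ g x ^ 2 :=
              pow_le_pow_left' ENNReal.mul_div_le 2
            refine h1.trans ?_
            by_cases hx : x ∈ B
            · simp only [hg, indicator_of_mem hx]
              rcases le_total (ρ x) ε with h | h
              · rw [max_eq_right h]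
                exact le_add_self
              · rw [max_eq_left h]
                exact le_self_add
            · simp [hg, indicator_of_notMem hx]
        _ = _ := by
            rw [lintegral_add_left (hρ.1.pow_const 2), lintegral_indicator hBm, setLIntegral_const]
  have hfin : hausdorffTwo Plane B ≠ ⊤ := (hausdorffTwo_ball_lt_top 0 1).ne
  have hc : Tendsto (fun ε : ℝ≥0 => (∫⁻ x, ρ x ^ 2 ∂hausdorffTwo Plane) +
      (ε : ℝ≥0∞) ^ 2 * hausdorffTwo Plane B) (𝓝[>] 0)
      (𝓝 ((∫⁻ x, ρ x ^ 2 ∂hausdorffTwo Plane) + ((0 : ℝ≥0) : ℝ≥0∞) ^ 2 *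
        hausdorffTwo Plane B)) := by
    refine Tendsto.mono_left (Continuous.tendsto ?_ 0) nhdsWithin_le_nhds
    refine continuous_const.add ?_
    exact (ENNReal.continuous_mul_const hfin).comp
      ((ENNReal.continuous_pow 2).comp ENNReal.continuous_coe)
  have h := ge_of_tendsto hc (eventually_mem_nhdsWithin.mono step)
  simpa using h

theorem isQCWith_iotaMap : IsQCWith 1 (iotaMap : Plane → WeightedPlane) := by
  refine ⟨iotaHomeo.isHomeomorph, le_rfl, fun Γ hΓ => ?_⟩
  simp only [ENNReal.coe_one, inv_one, one_mul]
  exact ⟨conformalModulus_le_image hΓ, image_conformalModulus_le hΓ⟩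

/-! ### Metric dilatation -/

section Dilatation

variable {X Y : Type*} [MetricSpace X] [MetricSpace Y]

theorem metricDilatation_le {f : X → Y} {x : X} {r a b : ℝ} (hb : 0 < b)
    (ha : ∀ y, dist x y ≤ r → dist (f x) (f y) ≤ a)
    (hb' : ∀ y, r ≤ dist x y → b ≤ dist (f x) (f y)) :
    metricDilatation f x r ≤ ENNReal.ofReal (a / b) := by
  rw [ENNReal.ofReal_div_of_pos hb]
  refine ENNReal.div_le_div (iSup₂_le fun y hy => ?_) (le_iInf₂ fun y hy => ?_)
  · rw [edist_dist]
    exact ENNReal.ofReal_le_ofReal (ha y hy)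
  · rw [edist_dist]
    exact ENNReal.ofReal_le_ofReal (hb' y hy)

theorem limsup_le_one_of_eventually_le {u : ℝ → ℝ≥0∞} {l : Filter ℝ}
    (h : ∀ t : ℝ, 1 < t → ∀ᶠ r in l, u r ≤ ENNReal.ofReal (t ^ 2)) : limsup u l ≤ 1 := by
  refine le_of_forall_le_rpow_mul 1 fun t ht => ?_
  rw [ENNReal.rpow_one, mul_one]
  exact limsup_le_of_le (h := h t ht)

end Dilatation

theorem eventually_mem_Ioo_nhdsGT_zero {c : ℝ} (hc : 0 < c) : ∀ᶠ r in 𝓝[>] (0 : ℝ), r ∈ Ioo 0 c :=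
  Ioo_mem_nhdsGT hc

/-- The bounds of `exists_local_bounds` for balls centred at `x`. -/
theorem exists_dist_iotaMap_bounds {x : Plane} (hx : x ≠ 0) {t : ℝ} (ht : 1 < t) :
    ∃ δ > 0, (∀ y, dist x y < δ → dist (iotaMap x) (iotaMap y) ≤ t * weight x * dist x y) ∧
      ∀ y, weight x / t * min δ (dist x y) ≤ dist (iotaMap x) (iotaMap y) := by
  obtain ⟨δ, hδ, -, hup, hlow⟩ := exists_local_bounds hx ht
  have hw := weight_pos hx
  have hxδ := Metric.mem_ball_self (x := x) hδ
  refine ⟨δ, hδ, fun y hy => ?_, fun y => ?_⟩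
  · have h := hup x hxδ y (by rwa [Metric.mem_ball, dist_comm])
    rwa [← edist_iotaMap, edist_dist, ENNReal.ofReal_le_ofReal_iff (by positivity)] at h
  · have h := hlow x hxδ y
    rw [← edist_iotaMap, edist_dist, ENNReal.ofReal_le_ofReal_iff dist_nonneg] at h
    refine le_trans ?_ h
    gcongr
    linarith

/-- At `0` the supremum is at most `ψ(r)` and the infimum at least `ψ(r)`. At other points the local
bounds give a quotient `t ^ 2`. -/
theorem isMQCWith_iotaMap : IsMQCWith 1 (iotaMap : Plane → WeightedPlane) := by
  refine ⟨iotaHomeo.isHomeomorph, fun x => ?_⟩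
  refine limsup_le_one_of_eventually_le fun t ht => ?_
  by_cases hx : x = 0
  · subst hx
    filter_upwards [self_mem_nhdsWithin] with r hr
    have hψ := expNegInvGlue.pos_of_pos (mem_Ioi.1 hr)
    refine (metricDilatation_le hψ (a := expNegInvGlue r) (fun y hy => ?_) fun y hy => ?_).trans ?_
    · rw [dist_iotaMap_zero]
      exact expNegInvGlue.monotone (by simpa using hy)
    · rw [dist_iotaMap_zero]
      exact expNegInvGlue.monotone (by simpa using hy)
    · rw [div_self hψ.ne']
      exact ENNReal.ofReal_le_ofReal (one_le_pow₀ ht.le)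
  · obtain ⟨δ, hδ, hup, hlow⟩ := exists_dist_iotaMap_bounds hx ht
    have hw := weight_pos hx
    filter_upwards [eventually_mem_Ioo_nhdsGT_zero hδ] with r hr
    have hr0 := hr.1
    refine (metricDilatation_le (a := t * weight x * r) (b := weight x / t * r) (by positivity)
      (fun y hy => ?_) fun y hy => ?_).trans (le_of_eq ?_)
    · refine (hup y (hy.trans_lt hr.2)).trans ?_
      gcongr
    · refine le_trans ?_ (hlow y)
      gcongr
      exact le_min hr.2.le hy
    · congr 1
      field_simp

theorem isMQCWith_iotaMap_symm : IsMQCWith 1 (iotaMap.symm : WeightedPlane → Plane) := by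
  refine ⟨iotaHomeo.symm.isHomeomorph, fun p => ?_⟩
  obtain ⟨x, rfl⟩ := iotaMap.surjective p
  refine limsup_le_one_of_eventually_le fun t ht => ?_
  by_cases hx : x = 0
  · subst hx
    filter_upwards [eventually_mem_Ioo_nhdsGT_zero one_pos] with r hr
    have hlog := Real.log_neg hr.1 hr.2
    obtain ⟨R, hR, hRr⟩ : ∃ R > 0, expNegInvGlue R = r := by
      -- The solution of `e^{-1/R} = r`, positive because `r < 1`.
      refine ⟨-(Real.log r)⁻¹, by simpa using hlog, ?_⟩
      have : ¬ -(Real.log r)⁻¹ ≤ 0 := by simpa using hlog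
      rw [expNegInvGlue, if_neg this, inv_neg, inv_inv, neg_neg, Real.exp_log hr.1]
    refine (metricDilatation_le hR (a := R) (fun q hq => ?_) fun q hq => ?_).trans ?_
    · obtain ⟨y, rfl⟩ := iotaMap.surjective q
      rw [dist_iotaMap_zero, ← hRr] at hq
      rw [Equiv.symm_apply_apply, Equiv.symm_apply_apply, dist_zero_left]
      exact (expNegInvGlue_strictMonoOn.le_iff_le (norm_nonneg y) hR.le).1 hq
    · obtain ⟨y, rfl⟩ := iotaMap.surjective q
      rw [dist_iotaMap_zero, ← hRr] at hq
      rw [Equiv.symm_apply_apply, Equiv.symm_apply_apply, dist_zero_left]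
      exact (expNegInvGlue_strictMonoOn.le_iff_le hR.le (norm_nonneg y)).1 hq
    · rw [div_self hR.ne']
      exact ENNReal.ofReal_le_ofReal (one_le_pow₀ ht.le)
  · obtain ⟨δ, hδ, hup, hlow⟩ := exists_dist_iotaMap_bounds hx ht
    have hw := weight_pos hx
    have ht0 : 0 < t := one_pos.trans ht
    -- The first threshold keeps the `d`-ball of radius `r` inside the Euclidean `δ`-ball; the
    -- second makes the lower bound automatic for points at Euclidean distance at least `δ`.
    filter_upwards [eventually_mem_Ioo_nhdsGT_zero (c := weight x / t * δ) (by positivity),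
      eventually_mem_Ioo_nhdsGT_zero (c := t * weight x * δ) (by positivity)] with r hr hr'
    have hr0 := hr.1
    refine (metricDilatation_le (a := r / (weight x / t)) (b := r / (t * weight x)) (by positivity)
      (fun q hq => ?_) fun q hq => ?_).trans (le_of_eq ?_)
    · obtain ⟨y, rfl⟩ := iotaMap.surjective q
      rw [Equiv.symm_apply_apply, Equiv.symm_apply_apply, le_div_iff₀' (by positivity)]
      have h := (hlow y).trans hq
      have hlt := lt_of_mul_lt_mul_left (h.trans_lt hr.2) (by positivity)
      rwa [min_eq_right] at h
      by_contra! hcon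
      rw [min_eq_left hcon.le] at hlt
      exact lt_irrefl _ hlt
    · obtain ⟨y, rfl⟩ := iotaMap.surjective q
      rw [Equiv.symm_apply_apply, Equiv.symm_apply_apply, div_le_iff₀' (by positivity)]
      rcases lt_or_ge (dist x y) δ with h | h
      · exact hq.trans (hup y h)
      · exact hr'.2.le.trans (by gcongr)
    · congr 1
      field_simp

/-! ### Failure of infinitesimal quasisymmetry -/

theorem not_isIQS_iotaMap : ¬ IsIQS (iotaMap : Plane → WeightedPlane) := by
  rintro ⟨-, η, h⟩
  obtain ⟨r, hr, H⟩ := h 0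
  -- Points of norms `1/u` and `1/(2u)` have distance ratio `2` from `0`, and image ratio `e^u ≥ u +
  -- 1 > η 2`. The summand `2 / r` puts both inside the ball.
  set u : ℝ := η 2 + 2 / r with hu
  have hη : (0 : ℝ) ≤ η 2 := NNReal.coe_nonneg _
  have hu0 : 0 < u := by positivity
  have hur : u⁻¹ < r := by
    rw [inv_lt_comm₀ hu0 hr, hu, ← one_div]
    have : 1 / r < 2 / r := by gcongr; norm_num
    linarith
  obtain ⟨y, hy⟩ := exists_norm_eq Plane (inv_pos.2 hu0).le
  have hy0 : y ≠ 0 := norm_ne_zero_iff.1 (hy ▸ (inv_pos.2 hu0).ne')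
  set z : Plane := (2⁻¹ : ℝ) • y with hz
  have hzn : ‖z‖ = (2 * u)⁻¹ := by
    rw [hz, norm_smul, hy, mul_inv]
    norm_num
  have hz0 : z ≠ 0 := smul_ne_zero (by norm_num) hy0
  have hzr : ‖z‖ < r := by
    refine lt_of_le_of_lt ?_ hur
    rw [hzn]
    gcongr
    linarith
  have hyz : y ≠ z := fun h => by
    have := congrArg norm h
    rw [hy, hzn, inv_inj] at this
    linarith
  have key := H y (by rwa [mem_ball_zero_iff, hy]) z (by rwa [mem_ball_zero_iff]) hy0.symm hz0.symm
    hyz 2 (by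
      rw [← NNReal.coe_le_coe, NNReal.coe_div, coe_nndist, coe_nndist, dist_zero_left,
        dist_zero_left, hy, hzn]
      apply le_of_eq
      rw [NNReal.coe_ofNat]
      field_simp)
  rw [← NNReal.coe_le_coe, NNReal.coe_div, coe_nndist, coe_nndist, dist_iotaMap_zero,
    dist_iotaMap_zero, hy, hzn, expNegInvGlue, expNegInvGlue, if_neg (by simpa using hu0),
    if_neg (by simpa using hu0), ← Real.exp_sub, inv_inv, inv_inv,
    show -u - -(2 * u) = u by ring] at key
  have : 0 < 2 / r := by positivity
  linarith [Real.add_one_le_exp u]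

/-! ### Composition with `h` -/

theorem dist_plane_eq (x y : Plane) :
    dist x y = Real.sqrt ((x 0 - y 0) ^ 2 + (x 1 - y 1) ^ 2) := by
  simp [EuclideanSpace.dist_eq, Fin.sum_univ_two, Real.dist_eq, sq_abs]

theorem dist_halfMap_symm (x y : Plane) :
    dist (halfMap.symm x) (halfMap.symm y) =
      Real.sqrt ((2 * x 0 - 2 * y 0) ^ 2 + (x 1 - y 1) ^ 2) :=
  dist_plane_eq _ _

theorem dist_le_dist_halfMap_symm (x y : Plane) :
    dist x y ≤ dist (halfMap.symm x) (halfMap.symm y) := by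
  rw [dist_plane_eq, dist_halfMap_symm]
  gcongr 1
  nlinarith [sq_nonneg (x 0 - y 0)]

theorem dist_halfMap_symm_le (x y : Plane) :
    dist (halfMap.symm x) (halfMap.symm y) ≤ 2 * dist x y := by
  rw [dist_halfMap_symm, dist_plane_eq]
  refine Real.sqrt_le_iff.2 ⟨by positivity, ?_⟩
  rw [mul_pow, Real.sq_sqrt (by positivity)]
  nlinarith [sq_nonneg (x 1 - y 1)]

/-- Following `ι⁻¹` by `h⁻¹` at most doubles the numerator of the dilatation and does not decrease
its denominator. -/
theorem isMQC_symm_halfMap_trans_iotaMap :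
    IsMQC ((halfMap.trans iotaMap).symm : WeightedPlane → Plane) := by
  refine ⟨2, by norm_num, (halfHomeo.trans iotaHomeo).symm.isHomeomorph, fun p => ?_⟩
  have hle : ∀ r, metricDilatation ((halfMap.trans iotaMap).symm : WeightedPlane → Plane) p r ≤
      2 * metricDilatation iotaMap.symm p r := fun r => by
    rw [metricDilatation, metricDilatation, ← mul_div_assoc]
    refine ENNReal.div_le_div (iSup₂_le fun q hq => ?_) (iInf₂_mono fun q _ => ?_)
    · refine le_trans ?_ (mul_le_mul' le_rfl (le_iSup₂ (f := fun q (_ : dist p q ≤ r) =>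
        edist (iotaMap.symm p) (iotaMap.symm q)) q hq))
      rw [edist_dist, edist_dist]
      refine (ENNReal.ofReal_le_ofReal (dist_halfMap_symm_le _ _)).trans (le_of_eq ?_)
      rw [ENNReal.ofReal_mul zero_le_two, ENNReal.ofReal_ofNat]
    · rw [edist_dist, edist_dist]
      exact ENNReal.ofReal_le_ofReal (dist_le_dist_halfMap_symm _ _)
  refine (limsup_le_limsup (Eventually.of_forall hle)).trans ?_
  rw [ENNReal.limsup_const_mul_of_ne_top (by simp)]
  refine (mul_le_mul' le_rfl (isMQCWith_iotaMap_symm.2 p)).trans (le_of_eq ?_)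
  simp

theorem not_isMQC_halfMap_trans_iotaMap :
    ¬ IsMQC (halfMap.trans iotaMap : Plane → WeightedPlane) := by
  rintro ⟨H, -, -, h⟩
  have h0 : halfMap 0 = 0 := by
    ext i
    fin_cases i <;> simp [halfMap]
  have hlt : limsup (metricDilatation (halfMap.trans iotaMap : Plane → WeightedPlane) 0)
      (𝓝[>] (0 : ℝ)) < (H : ℝ≥0∞) + 1 :=
    (h 0).trans_lt (ENNReal.lt_add_right ENNReal.coe_ne_top one_ne_zero)
  -- A radius with `1/r > H`, so that `e^{1/r} ≥ 1/r + 1 > H + 1`.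
  obtain ⟨r, ⟨hr, hrH⟩, hr0⟩ := (((eventually_lt_of_limsup_lt hlt).and
    (tendsto_inv_nhdsGT_zero.eventually_gt_atTop (H : ℝ))).and self_mem_nhdsWithin).exists
  refine hr.not_ge ?_
  have hd : ∀ y : Plane, edist ((halfMap.trans iotaMap) 0) ((halfMap.trans iotaMap) y) =
      ENNReal.ofReal (expNegInvGlue ‖halfMap y‖) := fun y => by
    rw [Equiv.trans_apply, Equiv.trans_apply, h0, edist_iotaMap, weightedEDist_zero_left]
  have hy1 : ‖(!₂[0, r] : Plane)‖ = r := by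
    simp [EuclideanSpace.norm_eq, Fin.sum_univ_two, Real.sqrt_sq hr0.le]
  have hy2 : ‖halfMap (!₂[0, r] : Plane)‖ = r := by
    simp [halfMap, EuclideanSpace.norm_eq, Fin.sum_univ_two, Real.sqrt_sq hr0.le]
  have hz1 : ‖(!₂[r, 0] : Plane)‖ = r := by
    simp [EuclideanSpace.norm_eq, Fin.sum_univ_two, Real.sqrt_sq hr0.le]
  have hz2 : ‖halfMap (!₂[r, 0] : Plane)‖ = r / 2 := by
    simp [halfMap, EuclideanSpace.norm_eq, Fin.sum_univ_two, Real.sqrt_sq (half_pos hr0).le]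
  calc (H : ℝ≥0∞) + 1 = ENNReal.ofReal (H + 1) := by
        rw [ENNReal.ofReal_add H.coe_nonneg zero_le_one, ENNReal.ofReal_coe_nnreal,
          ENNReal.ofReal_one]
    _ ≤ ENNReal.ofReal (Real.exp r⁻¹) :=
        ENNReal.ofReal_le_ofReal (by linarith [Real.add_one_le_exp r⁻¹])
    _ = ENNReal.ofReal (expNegInvGlue r / expNegInvGlue (r / 2)) := by
        rw [expNegInvGlue, expNegInvGlue, if_neg (not_le.2 hr0), if_neg (not_le.2 (half_pos hr0)),
          ← Real.exp_sub, inv_div]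
        congr 2
        field_simp
        norm_num
    _ = ENNReal.ofReal (expNegInvGlue r) / ENNReal.ofReal (expNegInvGlue (r / 2)) :=
        ENNReal.ofReal_div_of_pos (expNegInvGlue.pos_of_pos (half_pos hr0))
    _ ≤ _ := by
        -- The vertical point keeps its norm `r` under `h`, while the horizontal one drops to `r /
        -- 2`.
        refine ENNReal.div_le_div (le_iSup₂_of_le !₂[0, r] ?_ ?_) (iInf₂_le_of_le !₂[r, 0] ?_ ?_)
        · rw [dist_zero_left, hy1]
        · rw [hd, hy2]
        · rw [dist_zero_left, hz1]
        · rw [hd, hz2]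

end

theorem mainTheorem7 :
    IsMQCWith 1 (iotaMap : Plane → WeightedPlane) ∧
    IsMQCWith 1 (iotaMap.symm : WeightedPlane → Plane) ∧
    IsQCWith 1 (iotaMap : Plane → WeightedPlane) ∧
    ¬ IsIQS (iotaMap : Plane → WeightedPlane) ∧
    IsMQC ((halfMap.trans iotaMap).symm : WeightedPlane → Plane) ∧
    ¬ IsMQC (halfMap.trans iotaMap : Plane → WeightedPlane) :=
  ⟨isMQCWith_iotaMap, isMQCWith_iotaMap_symm, isQCWith_iotaMap, not_isIQS_iotaMap,
    isMQC_symm_halfMap_trans_iotaMap, not_isMQC_halfMap_trans_iotaMap⟩
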